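/- Let $q$ be an indeterminate, and let $(\beta_n)_{n\ge 0}$ be the Carlitz $q$-Bernoulli numbers, i.e. the elements of the field $\mathbb{Q}(q)$ determined by $$q\sum_{k=0}^{n}\binom{n}{k}q^k\beta_k-\beta_n=\begin{cases}q-1 & n=0,\\ 1 & n=1,\\ 0 & n>1.\end{cases}$$ Put $[n]_q=\frac{q^n-1}{q-1}$ and $\widehat{B}_2(x)=\frac{1}{\beta_2}\sum_{n\ge 0}\beta_{n+2}x^n\in\mathbb{Q}(q)[[x]]$. Then, as formal power series in $x$ (the finite truncations of the continued fraction converge coefficientwise), $$\widehat{B}_2(x)=\cfrac{1}{1+\cfrac{c_1x}{1+\cfrac{c_2x}{1+\cfrac{c_3x}{\ddots}}}}$$ where, for all $n\ge 1$, $$c_{2n-1}=\frac{[n]_q[n+1]_q^2}{[2n+1]_q[2n+2]_q}\cdot\frac{q^{\binom{n+2}{2}}+(-1)^{n+2}}{q^{\binom{n+1}{2}}+(-1)^{n+1}},\qquad c_{2n}=\frac{-q^{n+1}[n+1]_q^2[n+2]_q}{[2n+2]_q[2n+3]_q}\cdot\frac{q^{\binom{n+1}{2}}+(-1)^{n+1}}{q^{\binom{n+2}{2}}+(-1)^{n+2}}.$$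 For $n\ge 1$, the rational function $c_{2n-1}$ has a pole at $q=1$ if and only if $n$ is even, and $c_{2n}$ has a pole at $q=1$ if and only if $n$ is odd. Moreover there is no classical analogue: with $B_n$ the Bernoulli numbers, the series $\frac{1}{B_2}\sum_{n\ge 0}B_{n+2}x^n\in\mathbb{Q}[[x]]$ is not equal to any continued fraction of the above form with coefficients $c_k\in\mathbb{Q}$. -/

import Mathlib

/-!
Carlitz's `q`-Bernoulli numbers as elements of the field `ℚ(q)` of rational functions, their
twice shifted ordinary generating series, and Stieltjes continued fractions as formal power series.
-/

namespace QBernoulli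

noncomputable section

/-- The indeterminate `q` of the field `ℚ(q)`. -/
def q : RatFunc ℚ := RatFunc.X

/-- The `q`-integer `[n]_q = (q ^ n - 1) / (q - 1)`. -/
def qInt (n : ℕ) : RatFunc ℚ := (q ^ n - 1) / (q - 1)

/-- The right-hand side of Carlitz's relations: `q - 1`, `1`, `0`, `0`, … -/
def carlitzRhs (n : ℕ) : RatFunc ℚ := if n = 0 then q - 1 else if n = 1 then 1 else 0

/-- The `q`-Bernoulli-Carlitz numbers `β_n`: the relation `q (q β + 1) ^ n - β ^ n = carlitzRhs n`
(exponents of `β` read as indices after expansion) solved for `β_n`.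
See `carlitz_relation` and `eq_beta_of_carlitz_relation`. -/
def beta (n : ℕ) : RatFunc ℚ :=
  (carlitzRhs n - q * ∑ k : Fin n, (n.choose k : RatFunc ℚ) * q ^ (k : ℕ) * beta k) /
    (q ^ (n + 1) - 1)
decreasing_by exact k.isLt

theorem q_pow_succ_sub_one_ne_zero (n : ℕ) : q ^ (n + 1) - 1 ≠ 0 := by
  have h : (Polynomial.X ^ (n + 1) - Polynomial.C 1 : Polynomial ℚ) ≠ 0 :=
    Polynomial.X_pow_sub_C_ne_zero (Nat.succ_pos n) 1
  have h2 : algebraMap (Polynomial ℚ) (RatFunc ℚ) (Polynomial.X ^ (n + 1) - Polynomial.C 1) ≠ 0 :=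
    RatFunc.algebraMap_ne_zero h
  simpa [q] using h2

/-- Carlitz's defining relations
`q ∑_{k ≤ n} binom(n, k) q ^ k β_k - β_n = q - 1, 1, 0, 0, …`. -/
theorem carlitz_relation (n : ℕ) :
    q * ∑ k ∈ Finset.range (n + 1), (n.choose k : RatFunc ℚ) * q ^ k * beta k - beta n =
      carlitzRhs n := by
  have h := q_pow_succ_sub_one_ne_zero n
  have hb : beta n * (q ^ (n + 1) - 1) = carlitzRhs n -
      q * ∑ k ∈ Finset.range n, (n.choose k : RatFunc ℚ) * q ^ k * beta k := by
    rw [beta, div_mul_cancel₀ _ h, Finset.sum_range]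
  rw [Finset.sum_range_succ, Nat.choose_self, Nat.cast_one]
  linear_combination hb

/-- Carlitz's relations determine the sequence `β`. -/
theorem eq_beta_of_carlitz_relation (b : ℕ → RatFunc ℚ)
    (hb : ∀ n : ℕ, q * ∑ k ∈ Finset.range (n + 1), (n.choose k : RatFunc ℚ) * q ^ k * b k - b n =
      carlitzRhs n) (n : ℕ) : b n = beta n := by
  induction n using Nat.strong_induction_on with
  | _ n ih =>
    have h1 := hb n
    have h2 := carlitz_relation n
    have hs : ∑ k ∈ Finset.range n, (n.choose k : RatFunc ℚ) * q ^ k * b k =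
        ∑ k ∈ Finset.range n, (n.choose k : RatFunc ℚ) * q ^ k * beta k :=
      Finset.sum_congr rfl fun k hk => by rw [ih k (Finset.mem_range.1 hk)]
    rw [Finset.sum_range_succ, Nat.choose_self, Nat.cast_one] at h1 h2
    rw [hs] at h1
    refine mul_right_cancel₀ (q_pow_succ_sub_one_ne_zero n) ?_
    linear_combination h1 - h2

/-- The series `B̂₂(x) = (1 / β_2) ∑_{n ≥ 0} β_{n+2} x ^ n`, a formal power series over `ℚ(q)`. -/
def Bhat2 : PowerSeries (RatFunc ℚ) := PowerSeries.mk fun n => beta (n + 2) / beta 2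

/-- The classical counterpart `(1 / B_2) ∑_{n ≥ 0} B_{n+2} x ^ n` with the Bernoulli numbers. -/
def classicalBhat2 : PowerSeries ℚ := PowerSeries.mk fun n => bernoulli (n + 2) / bernoulli 2

/-- The finite continued fraction `1/(1 + c_1 x/(1 + c_2 x/(⋯/(1 + c_m x))))`, a formal power series
in `x` over the field `K`; the entry `c 0` plays no role. Every denominator has constant term `1`,
so every inverse is a genuine one. -/
def sConvergent {K : Type*} [Field K] : ℕ → (ℕ → K) → PowerSeries K
  | 0, _ => 1
  | m + 1, c =>
    (1 + PowerSeries.C (c 1) * PowerSeries.X * sConvergent m (fun k => c (k + 1)))⁻¹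

/-- `F = 1/(1 + c_1 x/(1 + c_2 x/(1 + c_3 x/⋯)))` as formal power series: the finite continued
fractions converge to `F`, i.e. each coefficient is eventually that of `F`. -/
def IsSFraction {K : Type*} [Field K] (F : PowerSeries K) (c : ℕ → K) : Prop :=
  ∀ n : ℕ, ∀ᶠ m in Filter.atTop, PowerSeries.coeff n (sConvergent m c) = PowerSeries.coeff n F

/-- The rational function `f` has a pole at `a`: its reduced denominator vanishes there. -/
def HasPoleAt (f : RatFunc ℚ) (a : ℚ) : Prop := f.denom.eval a = 0

end

end QBernoulli

/-! Let L be the functional with L(X^n) = β_n, and M(f) = L(X^2 f). Carlitz's relations say q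
L(f(1+qX)) - L(f) = (q-1) f(0) + f'(0). The substitution X ↦ 1+qX sends [j] to [j+1], so it acts
simply on products of factors X - [j]. This gives L of such products in closed form
(`umbral_qFalling`), hence M on f_k = (X-[1])⋯(X-[k]).

A continued fraction with coefficients c generates monic polynomials P_n satisfying a three-term
recurrence that involves c only through c_1, the sums c_{2n+2} + c_{2n+3} and the products c_{2n+1}
c_{2n+2}. By `isSFraction_of_functional` it expands the normalised moments of M as soon as M(P_n) =
0 for n ≥ 1. This holds because M(f_k P_n) equals `kernelValue`, which contains ∏_{i<n} (q^k - q^i)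
and so vanishes at k = 0.

Write T_m = q^(m choose 2) + (-1)^m. The factors T_m drop out of those sums and products, so they
are invisible to the P_n. They are what produces the poles: T_m vanishes at q = 1 exactly for odd m.
Classically, B_3 = 0 forces c_1 = 0, which truncates the fraction to 1 although B_4 ≠ 0. -/

open Polynomial in
/-- The linear functional on polynomials with prescribed moments. -/
noncomputable def umbral {K : Type*} [Field K] (β : ℕ → K) : K[X] →ₗ[K] K :=
  Polynomial.lsum fun n => β n • LinearMap.id

/-! ### Continued fractions from orthogonality of polynomials -/

section ContinuedFraction

open Polynomial

variable {K : Type*} [Field K]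

theorem umbral_monomial (β : ℕ → K) (n : ℕ) (a : K) : umbral β (monomial n a) = β n * a := by
  simp [umbral, Polynomial.lsum_apply, Polynomial.sum_monomial_index]

theorem umbral_X_pow (β : ℕ → K) (n : ℕ) : umbral β (X ^ n) = β n := by
  rw [← monomial_one_right_eq_X_pow, umbral_monomial, mul_one]

theorem map_C_mul (M : K[X] →ₗ[K] K) (a : K) (p : K[X]) : M (C a * p) = a * M p := by
  rw [← smul_eq_C_mul, map_smul, smul_eq_mul]

/-- If `x H_{k+2} = H_{k+1} + c_{k+1} H_k`, then `H_{k+1} / H_k` is, up to the factor `-c_{k+1}`,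
approximated by the convergents of the shifted continued fraction. -/
theorem X_pow_dvd_add_sConvergent (H : ℕ → PowerSeries K) (c : ℕ → K)
    (hH : ∀ k, PowerSeries.X * H (k + 2) = H (k + 1) + PowerSeries.C (c (k + 1)) * H k)
    (m k : ℕ) :
    PowerSeries.X ^ m ∣ H (k + 1) + PowerSeries.C (c (k + 1)) * H k *
      QBernoulli.sConvergent m (fun j => c (j + (k + 1))) := by
  induction m generalizing k with
  | zero => simp
  | succ m ih =>
    obtain ⟨G, hG⟩ := ih (k + 1)
    rw [QBernoulli.sConvergent]
    have hs : (fun j => c (j + 1 + (k + 1))) = fun j => c (j + (k + 1 + 1)) := by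
      funext j; congr 1; ring
    rw [hs, show 1 + (k + 1) = k + 1 + 1 by ring]
    set S := QBernoulli.sConvergent m fun j => c (j + (k + 1 + 1))
    set U := 1 + PowerSeries.C (c (k + 1 + 1)) * PowerSeries.X * S with hU
    have hc : PowerSeries.constantCoeff U ≠ 0 := by simp [hU]
    have hinv : U * U⁻¹ = 1 := PowerSeries.mul_inv_cancel U hc
    refine ⟨G * U⁻¹, ?_⟩
    have h1 : (H (k + 1) + PowerSeries.C (c (k + 1)) * H k * U⁻¹) =
        (H (k + 1) * U + PowerSeries.C (c (k + 1)) * H k) * U⁻¹ := by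
      linear_combination (-H (k + 1)) * hinv
    rw [h1, pow_succ, show PowerSeries.X ^ m * PowerSeries.X * (G * U⁻¹) =
      PowerSeries.X * (PowerSeries.X ^ m * G) * U⁻¹ by ring, ← hG]
    congr 1
    rw [hU]
    linear_combination -(hH k)

/-- Up to high powers of x, H_1 is -c_1 H_0 S with S a convergent of the shifted fraction.
Substituting in H_0 = 1 + x H_1 gives H_0 (1 + c_1 x S) ≈ 1, and the factor x gains one order of
accuracy. -/
theorem isSFraction_of_recurrence (H : ℕ → PowerSeries K) (c : ℕ → K)
    (h0 : H 0 = 1 + PowerSeries.X * H 1)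
    (hH : ∀ k, PowerSeries.X * H (k + 2) = H (k + 1) + PowerSeries.C (c (k + 1)) * H k) :
    QBernoulli.IsSFraction (H 0) c := by
  have key : ∀ m, PowerSeries.X ^ (m + 1) ∣ H 0 - QBernoulli.sConvergent (m + 1) c := by
    intro m
    obtain ⟨G, hG⟩ := X_pow_dvd_add_sConvergent H c hH m 0
    rw [QBernoulli.sConvergent]
    simp only [zero_add] at hG
    set S := QBernoulli.sConvergent m fun j => c (j + 1)
    set U := 1 + PowerSeries.C (c 1) * PowerSeries.X * S with hU
    have hc : PowerSeries.constantCoeff U ≠ 0 := by simp [hU]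
    have hinv : U * U⁻¹ = 1 := PowerSeries.mul_inv_cancel U hc
    refine ⟨G * U⁻¹, ?_⟩
    rw [pow_succ, show PowerSeries.X ^ m * PowerSeries.X * (G * U⁻¹) =
      PowerSeries.X * (PowerSeries.X ^ m * G) * U⁻¹ by ring, ← hG]
    have h1 : H 0 - U⁻¹ = (H 0 * U - 1) * U⁻¹ := by linear_combination (-H 0) * hinv
    rw [h1]
    congr 1
    rw [hU]
    linear_combination h0
  intro n
  filter_upwards [Filter.eventually_ge_atTop (n + 1)] with m hm
  obtain ⟨m, rfl⟩ := Nat.exists_eq_add_of_le' (show 1 ≤ m by omega)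
  have := PowerSeries.X_pow_dvd_iff.1 (key m) n (by omega)
  rw [map_sub, sub_eq_zero] at this
  exact this.symm

/-- Favard-type criterion: the polynomials produced by the coefficients of a continued fraction
determine the functional whose moments it generates. -/
theorem isSFraction_of_functional (M : K[X] →ₗ[K] K) (c : ℕ → K) (P B : ℕ → K[X])
    (hP0 : P 0 = 1) (hB0 : B 0 = 1)
    (hP : ∀ n, P (n + 1) = X * B n + C (c (2 * n + 1)) * P n)
    (hB : ∀ n, B (n + 1) = P (n + 1) + C (c (2 * n + 2)) * B n)
    (hM0 : M 1 = 1) (hM : ∀ n, M (P (n + 1)) = 0) :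
    QBernoulli.IsSFraction (PowerSeries.mk fun n => M (X ^ n)) c := by
  -- Eliminating B leaves the three-term recurrence of the P_n.
  have hPP : ∀ n, X * P (n + 1) = P (n + 2) - C (c (2 * n + 2) + c (2 * n + 3)) * P (n + 1) +
      C (c (2 * n + 1) * c (2 * n + 2)) * P n := by
    intro n
    have h1 := hP (n + 1)
    rw [hB n, show 2 * (n + 1) + 1 = 2 * n + 3 by ring] at h1
    rw [h1]
    simp only [C_add, C_mul]
    linear_combination C (c (2 * n + 2)) * hP n
  -- The recurrence trades X^(j+1) P_(n+1) for X^j times P_(n+2), P_(n+1) and P_n, whose indices all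
  -- still exceed j.
  have horth : ∀ j n, j < n → M (X ^ j * P n) = 0 := by
    intro j
    induction j with
    | zero =>
      intro n hn
      obtain ⟨n, rfl⟩ := Nat.exists_eq_add_of_le' hn
      simpa using hM n
    | succ j ih =>
      intro n hn
      obtain ⟨n, rfl⟩ := Nat.exists_eq_add_of_le' (show 1 ≤ n by omega)
      rw [pow_succ, mul_assoc, hPP n]
      rw [show X ^ j * (P (n + 2) - C (c (2 * n + 2) + c (2 * n + 3)) * P (n + 1) +
        C (c (2 * n + 1) * c (2 * n + 2)) * P n) = X ^ j * P (n + 2) -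
        C (c (2 * n + 2) + c (2 * n + 3)) * (X ^ j * P (n + 1)) +
        C (c (2 * n + 1) * c (2 * n + 2)) * (X ^ j * P n) by ring]
      rw [map_add, map_sub, map_C_mul, map_C_mul, ih _ (by omega), ih _ (by omega),
        ih _ (by omega)]
      simp
  -- The exponents are shifted to skip the initial moments killed by orthogonality. In the
  -- recurrence for H, orthogonality is needed only at the constant coefficient, where x H_(k+2)
  -- contributes 0.
  set H : ℕ → PowerSeries K := fun k => if Even k
    then PowerSeries.mk fun m => M (X ^ (m + k / 2) * P (k / 2))
    else PowerSeries.mk fun m => M (X ^ (m + k / 2 + 1) * B (k / 2)) with hH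
  have hHe : ∀ n, H (2 * n) = PowerSeries.mk fun m => M (X ^ (m + n) * P n) := by
    intro n; simp [hH]
  have hHo : ∀ n, H (2 * n + 1) = PowerSeries.mk fun m => M (X ^ (m + n + 1) * B n) := by
    intro n
    have : ¬ Even (2 * n + 1) := by simp
    simp only [hH, if_neg this, show (2 * n + 1) / 2 = n by omega]
  have hBP : ∀ m n, M (X ^ (m + 1) * B n) = M (X ^ m * P (n + 1)) -
      c (2 * n + 1) * M (X ^ m * P n) := by
    intro m n
    rw [hP n, ← map_C_mul, ← map_sub]
    congr 1
    ring
  have hF : (PowerSeries.mk fun n => M (X ^ n)) = H 0 := by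
    rw [show (0 : ℕ) = 2 * 0 from rfl, hHe]; simp [hP0]
  rw [hF]
  refine isSFraction_of_recurrence H c ?_ ?_
  · rw [← hF, show 1 = 2 * 0 + 1 from rfl, hHo]
    ext n
    rcases n with _ | n
    · simp [hM0]
    · rw [map_add, PowerSeries.coeff_succ_X_mul]
      simp [hB0, PowerSeries.coeff_one]
  · intro k
    rcases Nat.even_or_odd' k with ⟨n, rfl | rfl⟩
    · rw [show 2 * n + 2 = 2 * (n + 1) by ring, hHe, hHe, hHo]
      ext m
      rcases m with _ | m
      · rw [PowerSeries.coeff_zero_X_mul]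
        simp only [map_add, PowerSeries.coeff_C_mul, PowerSeries.coeff_mk, zero_add]
        rw [hBP, horth n (n + 1) (by omega)]
        ring
      · rw [PowerSeries.coeff_succ_X_mul]
        simp only [map_add, PowerSeries.coeff_C_mul, PowerSeries.coeff_mk]
        rw [hBP, show m + (n + 1) = m + 1 + n by ring]
        ring
    · rw [show 2 * n + 1 + 2 = 2 * (n + 1) + 1 by ring, show 2 * n + 1 + 1 = 2 * (n + 1) by ring,
        hHe, hHo, hHo]
      have hBB : ∀ m, M (X ^ m * B (n + 1)) = M (X ^ m * P (n + 1)) +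
          c (2 * n + 2) * M (X ^ m * B n) := by
        intro m
        rw [hB n, ← map_C_mul, ← map_add]
        congr 1
        ring
      ext m
      rcases m with _ | m
      · rw [PowerSeries.coeff_zero_X_mul]
        simp only [map_add, PowerSeries.coeff_C_mul, PowerSeries.coeff_mk, zero_add]
        rw [show 2 * (n + 1) = 2 * n + 2 by ring, ← hBB, hBP, horth n _ (by omega),
          horth n _ (by omega)]
        simp
      · rw [PowerSeries.coeff_succ_X_mul]
        simp only [map_add, PowerSeries.coeff_C_mul, PowerSeries.coeff_mk]
        rw [show 2 * (n + 1) = 2 * n + 2 by ring, show m + (n + 1) + 1 = m + 1 + n + 1 by ring,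
          show m + 1 + (n + 1) = m + 1 + n + 1 by ring, hBB]

end ContinuedFraction

/-! ### Carlitz's functional on q-falling factorials -/

section CarlitzFunctional

open Polynomial

variable {K : Type*} [Field K]

/-- The `q`-integer `[n]_q` at an element `q` of a field. -/
def qNum (q : K) (n : ℕ) : K := (q ^ n - 1) / (q - 1)

/-- The `q`-factorial `[n]_q!`. -/
def qFac (q : K) (n : ℕ) : K := ∏ i ∈ Finset.range n, qNum q (i + 1)

/-- The polynomial `(X - [a]) (X - [a + 1]) ⋯ (X - [a + k - 1])`. -/
noncomputable def qFalling (q : K) (a k : ℕ) : K[X] :=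
  ∏ i ∈ Finset.range k, (X - C (qNum q (i + a)))

theorem qFac_succ (q : K) (n : ℕ) : qFac q (n + 1) = qFac q n * qNum q (n + 1) :=
  Finset.prod_range_succ _ _

theorem qFalling_succ (q : K) (a k : ℕ) :
    qFalling q a (k + 1) = qFalling q a k * (X - C (qNum q (k + a))) :=
  Finset.prod_range_succ _ _

theorem qFalling_zero_succ (q : K) (k : ℕ) : qFalling q 0 (k + 1) = X * qFalling q 1 k := by
  simp only [qFalling]
  rw [Finset.prod_range_succ']
  simp [qNum, mul_comm]

theorem qNum_mul {q : K} (h1 : q - 1 ≠ 0) (n : ℕ) : qNum q n * (q - 1) = q ^ n - 1 :=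
  div_mul_cancel₀ _ h1

/-- Each factor becomes 1 + qX - [j+1] = q (X - [j]). -/
theorem qFalling_one_comp {q : K} (h1 : q - 1 ≠ 0) (k : ℕ) :
    (qFalling q 1 k).comp (1 + C q * X) = C (q ^ k) * qFalling q 0 k := by
  induction k with
  | zero => simp [qFalling]
  | succ k ih =>
    rw [qFalling_succ, qFalling_succ, mul_comp, ih]
    have h : (1 : K) - qNum q (k + 1) = -(q * qNum q (k + 0)) := by
      rw [qNum, qNum]
      field_simp
      ring
    have h' : (1 : K[X]) - C (qNum q (k + 1)) = -(C q * C (qNum q (k + 0))) := by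
      rw [← C_1, ← C_sub, h, C_neg, C_mul]
    simp only [sub_comp, X_comp, C_comp, pow_succ, C_mul]
    linear_combination C (q ^ k) * qFalling q 0 k * h'

theorem qFalling_one_eval_zero (q : K) (k : ℕ) :
    (qFalling q 1 k).eval 0 = (-1) ^ k * qFac q k := by
  simp [qFalling, qFac, eval_prod, Finset.prod_neg]

/-- Both sides are linear in f, and on X^n this is the n-th Carlitz relation; the right-hand side
encodes the values q-1, 1, 0, 0, …. -/
theorem umbral_comp {q : K} {β : ℕ → K} {r : ℕ → K}
    (hβ : ∀ n, q * ∑ k ∈ Finset.range (n + 1), (n.choose k : K) * q ^ k * β k - β n = r n)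
    (hr0 : r 0 = q - 1) (hr1 : r 1 = 1) (hr : ∀ n, r (n + 2) = 0) (f : K[X]) :
    q * umbral β (f.comp (1 + C q * X)) - umbral β f =
      (q - 1) * f.eval 0 + f.derivative.eval 0 := by
  induction f using Polynomial.induction_on' with
  | add f g hf hg =>
    rw [add_comp, map_add, map_add, derivative_add, eval_add, eval_add]
    linear_combination hf + hg
  | monomial n a =>
    have h1 : (monomial n a).comp (1 + C q * X) =
        ∑ k ∈ Finset.range (n + 1), C (a * (n.choose k : K) * q ^ k) * X ^ k := by
      rw [monomial_comp, add_comm, add_pow, Finset.mul_sum]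
      refine Finset.sum_congr rfl fun k _ => ?_
      simp only [one_pow, mul_one, mul_pow, C_mul, C_pow, map_natCast]
      ring
    have h2 : umbral β ((monomial n a).comp (1 + C q * X)) =
        a * ∑ k ∈ Finset.range (n + 1), (n.choose k : K) * q ^ k * β k := by
      rw [h1, map_sum, Finset.mul_sum]
      refine Finset.sum_congr rfl fun k _ => ?_
      rw [map_C_mul, umbral_X_pow]
      ring
    rw [h2, umbral_monomial, derivative_monomial]
    have h3 : q * (a * ∑ k ∈ Finset.range (n + 1), (n.choose k : K) * q ^ k * β k) - β n * a =
        a * r n := by rw [← hβ n]; ring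
    rw [h3]
    rcases n with _ | _ | n
    · simp [hr0, mul_comm]
    · simp [hr1]
    · simp [hr]

variable {q : K} {β : ℕ → K} {r : ℕ → K}

/-- Since 1 + qX = q (X - [k]) + [k+1], applying `umbral_comp` to the product of length k+1 yields a
first-order recursion in k. -/
theorem umbral_qFalling (hq : ∀ n, q ^ (n + 1) - 1 ≠ 0)
    (hβ : ∀ n, q * ∑ k ∈ Finset.range (n + 1), (n.choose k : K) * q ^ k * β k - β n = r n)
    (hr0 : r 0 = q - 1) (hr1 : r 1 = 1) (hr : ∀ n, r (n + 2) = 0) (k : ℕ) :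
    umbral β (qFalling q 0 k) = (-1) ^ k * qFac q k / qNum q (k + 1) := by
  have h1 : q - 1 ≠ 0 := by simpa using hq 0
  have hn : ∀ n, qNum q (n + 1) ≠ 0 := fun n => div_ne_zero (hq n) h1
  induction k with
  | zero =>
    have := umbral_comp hβ hr0 hr1 hr 1
    have h2 : umbral β 1 * (q - 1) = 1 * (q - 1) := by
      simp at this
      linear_combination this
    simpa [qFalling, qFac, qNum, div_self h1] using mul_right_cancel₀ h1 h2
  | succ k ih =>
    have h := umbral_comp hβ hr0 hr1 hr (qFalling q 0 (k + 1))
    have h2 : (qFalling q 0 (k + 1)).comp (1 + C q * X) =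
        C (q ^ (k + 1)) * qFalling q 0 (k + 1) + C (q ^ k * qNum q (k + 1)) * qFalling q 0 k := by
      rw [qFalling_zero_succ, mul_comp, qFalling_one_comp h1, ← qFalling_zero_succ, qFalling_succ]
      have h3 : qNum q (k + 1) = q * qNum q (k + 0) + 1 := by
        rw [qNum, qNum]
        field_simp
        ring
      rw [h3]
      simp only [X_comp, C_mul, C_add, pow_succ, C_1]
      ring
    have h4 : (qFalling q 0 (k + 1)).derivative.eval 0 = (-1) ^ k * qFac q k := by
      rw [qFalling_zero_succ, derivative_mul]
      simp [qFalling_one_eval_zero]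
    have h5 : (qFalling q 0 (k + 1)).eval 0 = 0 := by
      rw [qFalling_zero_succ]
      simp
    rw [h2, h4, h5, map_add, map_C_mul, map_C_mul, ih] at h
    have h6 : umbral β (qFalling q 0 (k + 1)) * (q ^ (k + 2) - 1) =
        (-1) ^ k * qFac q k * (1 - q ^ (k + 1)) := by
      have h7 : (-1) ^ k * qFac q k / qNum q (k + 1) * qNum q (k + 1) = (-1) ^ k * qFac q k :=
        div_mul_cancel₀ _ (hn k)
      linear_combination h - q ^ (k + 1) * h7
    rw [eq_div_iff (hn (k + 1))]
    refine mul_right_cancel₀ h1 ?_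
    rw [mul_assoc, qNum_mul h1, h6, qFac_succ]
    linear_combination (-(-1) ^ (k + 1) * qFac q k) * qNum_mul h1 (k + 1)

/-- The functional `f ↦ L(x ^ 2 f)` for a functional `L`. -/
noncomputable def shiftTwo (M : K[X] →ₗ[K] K) : K[X] →ₗ[K] K :=
  M ∘ₗ LinearMap.mulLeft K (X ^ 2)

theorem shiftTwo_apply (M : K[X] →ₗ[K] K) (f : K[X]) : shiftTwo M f = M (X ^ 2 * f) := rfl

theorem X_mul_qFalling (q : K) (a k : ℕ) :
    X * qFalling q a k = qFalling q a (k + 1) + C (qNum q (k + a)) * qFalling q a k := by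
  rw [qFalling_succ]
  ring

/-- One factor X turns the product starting at [1] into one starting at [0]; the other splits it
into two terms, which combine by [k+2]^2 - [k+1][k+3] = q^(k+1). -/
theorem shiftTwo_umbral_qFalling (hq : ∀ n, q ^ (n + 1) - 1 ≠ 0)
    (hβ : ∀ n, q * ∑ k ∈ Finset.range (n + 1), (n.choose k : K) * q ^ k * β k - β n = r n)
    (hr0 : r 0 = q - 1) (hr1 : r 1 = 1) (hr : ∀ n, r (n + 2) = 0) (k : ℕ) :
    shiftTwo (umbral β) (qFalling q 1 k) =
      (-1) ^ k * q ^ (k + 1) * qFac q (k + 1) ^ 2 / qFac q (k + 3) := by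
  have h1 : q - 1 ≠ 0 := by simpa using hq 0
  have hn : ∀ n, qNum q (n + 1) ≠ 0 := fun n => div_ne_zero (hq n) h1
  have hf : ∀ n, qFac q n ≠ 0 := fun n => Finset.prod_ne_zero_iff.2 fun i _ => hn i
  rw [shiftTwo_apply, pow_two, mul_assoc, ← qFalling_zero_succ, X_mul_qFalling, map_add, map_C_mul,
    umbral_qFalling hq hβ hr0 hr1 hr, umbral_qFalling hq hβ hr0 hr1 hr]
  have key : qNum q (k + 2) ^ 2 - qNum q (k + 1) * qNum q (k + 3) = q ^ (k + 1) := by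
    rw [qNum, qNum, qNum]
    field_simp
    ring
  have a1 := hn (k + 1)
  have a2 := hn (k + 2)
  have a3 := hf (k + 1)
  rw [qFac_succ q (k + 2), qFac_succ q (k + 1), ← key]
  simp only [add_assoc, Nat.reduceAdd, add_zero] at a1 a2 a3 ⊢
  field_simp
  ring

end CarlitzFunctional

/-! ### Closed form of the mixed moments and recurrence coefficients -/

section Orthogonality

open Polynomial

variable {K : Type*} [Field K]

/-- The constants in the closed form for `L(x ^ 2 P_n f_k)`. -/
def kernelScale (q : K) (n : ℕ) : K :=
  ∏ i ∈ Finset.range n, q * qNum q (i + 2) ^ 2 * qNum q (i + 3) /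
    (qNum q (2 * i + 3) * qNum q (2 * i + 4) * (q - 1))

/-- The closed form for `L(x ^ 2 P_n f_k)`, where `f_k = (x - [1]) ⋯ (x - [k])`. -/
def kernelValue (q : K) (n k : ℕ) : K :=
  kernelScale q n * ((-1) ^ k * q ^ (k + 1) * qFac q (k + 1) ^ 2) *
    (∏ i ∈ Finset.range n, (q ^ k - q ^ i)) / qFac q (k + n + 3)

/-- The diagonal coefficient of the three-term recurrence. -/
def recDiag (q : K) (n : ℕ) : K :=
  q ^ (n + 1) * qNum q (n + 1) ^ 2 * qNum q (n + 2) / (qNum q (2 * n + 2) * qNum q (2 * n + 3)) -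
    qNum q (n + 1) * qNum q (n + 2) ^ 2 / (qNum q (2 * n + 3) * qNum q (2 * n + 4))

/-- The off-diagonal coefficient of the three-term recurrence. -/
def recOff (q : K) (n : ℕ) : K :=
  -(q ^ (n + 2) * qNum q (n + 1) * qNum q (n + 2) ^ 4 * qNum q (n + 3)) /
    (qNum q (2 * n + 3) * qNum q (2 * n + 4) ^ 2 * qNum q (2 * n + 5))

theorem prod_pow_sub_pow_succ (q : K) (n k : ℕ) :
    ∏ i ∈ Finset.range (n + 1), (q ^ (k + 1) - q ^ i) =
      (q ^ (k + 1) - 1) * q ^ n * ∏ i ∈ Finset.range n, (q ^ k - q ^ i) := by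
  rw [Finset.prod_range_succ', pow_zero]
  have : ∀ i ∈ Finset.range n, q ^ (k + 1) - q ^ (i + 1) = q * (q ^ k - q ^ i) :=
    fun i _ => by ring
  rw [Finset.prod_congr rfl this, Finset.prod_mul_distrib, Finset.prod_const, Finset.card_range]
  ring

theorem kernelScale_succ (q : K) (n : ℕ) :
    kernelScale q (n + 1) = kernelScale q n * (q * qNum q (n + 2) ^ 2 * qNum q (n + 3) /
      (qNum q (2 * n + 3) * qNum q (2 * n + 4) * (q - 1))) :=
  Finset.prod_range_succ _ _

end Orthogonality

/-! ### The closed form satisfies the three-term recurrence -/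

section ThreeTerm

open Polynomial

variable {K : Type*} [Field K] {q : K}

theorem three_term_identity_zero {w u d1 d2 d3 d4 d5 : K} (hw : w ≠ 0) (h3 : d3 ≠ 0)
    (h4 : d4 ≠ 0) (h5 : d5 ≠ 0) (e : w = q - 1) (e1 : d1 = u * q - 1) (e2 : d2 = u * q ^ 2 - 1)
    (e3 : d3 = q ^ 3 - 1) (e4 : d4 = q ^ 4 - 1) (e5 : d5 = u * q ^ 4 - 1) :
    q * ((q ^ 2 - 1) / w) ^ 2 * (d3 / w) / (d3 / w * (d4 / w) * w) * (u - 1) =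
      -(q * (d2 / w) ^ 2) + (d1 / w + (q * 1 ^ 2 * ((q ^ 2 - 1) / w) /
        ((q ^ 2 - 1) / w * (d3 / w)) - 1 * ((q ^ 2 - 1) / w) ^ 2 / (d3 / w * (d4 / w)))) *
        (d5 / w) := by
  by_cases h2 : q ^ 2 - 1 = 0
  · exact absurd (show d4 = 0 by rw [e4]; linear_combination (q ^ 2 + 1) * h2) h4
  field_simp
  subst_vars
  ring

/-- The recurrence of `kernelValue` divided by its common factor, with w = q-1, u = q^k, s = q^n,
a_i = q^(n+i) - 1 and d_i = q^(2n+i) - 1. -/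
theorem three_term_identity {w u s a1 a2 a3 a4 d3 d4 d5 d6 : K} (hw : w ≠ 0)
    (h3 : d3 ≠ 0) (h4 : d4 ≠ 0) (h5 : d5 ≠ 0) (h6 : d6 ≠ 0) (e : w = q - 1)
    (e1 : a1 = s * q - 1) (e2 : a2 = s * q ^ 2 - 1) (e3 : a3 = s * q ^ 3 - 1)
    (e4 : a4 = s * q ^ 4 - 1) (e5 : d3 = s ^ 2 * q ^ 3 - 1) (e6 : d4 = s ^ 2 * q ^ 4 - 1)
    (e7 : d5 = s ^ 2 * q ^ 5 - 1) (e8 : d6 = s ^ 2 * q ^ 6 - 1) :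
    q * (a2 / w) ^ 2 * (a3 / w) / (d3 / w * (d4 / w) * w) *
    (q * (a3 / w) ^ 2 * (a4 / w) / (d5 / w * (d6 / w) * w)) * ((u - s) * (u - s * q)) =
    q * (a2 / w) ^ 2 * (a3 / w) / (d3 / w * (d4 / w) * w) *
      (-(q * ((u * q ^ 2 - 1) / w) ^ 2 * ((u * q - 1) * s))) +
    ((u * q - 1) / w + (s * q ^ 2 * (a2 / w) ^ 2 * (a3 / w) / (d4 / w * (d5 / w)) -
        a2 / w * (a3 / w) ^ 2 / (d5 / w * (d6 / w)))) *
      (q * (a2 / w) ^ 2 * (a3 / w) / (d3 / w * (d4 / w) * w) * (u - s) *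
        ((u * s * q ^ 5 - 1) / w)) -
    -(s * q ^ 2 * (a1 / w) * (a2 / w) ^ 4 * (a3 / w)) / (d3 / w * (d4 / w) ^ 2 * (d5 / w)) *
      ((u * s * q ^ 5 - 1) / w * ((u * s * q ^ 4 - 1) / w)) := by
  -- Differences of squares: they show a2, a3 ≠ 0 and expose the common factors of the denominators.
  have hd4 : d4 = a2 * (s * q ^ 2 + 1) := by subst_vars; ring
  have hd6 : d6 = a3 * (s * q ^ 3 + 1) := by subst_vars; ring
  obtain ⟨ha2, hb2⟩ := mul_ne_zero_iff.1 (hd4 ▸ h4)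
  obtain ⟨ha3, hb3⟩ := mul_ne_zero_iff.1 (hd6 ▸ h6)
  -- The factors are kept as atoms while denominators are cleared; `subst_vars` restores them for
  -- `ring`.
  generalize hg2 : s * q ^ 2 + 1 = b2 at hd4 hb2
  generalize hg3 : s * q ^ 3 + 1 = b3 at hd6 hb3
  generalize hg4 : u * s * q ^ 5 - 1 = f5
  generalize hg5 : u * s * q ^ 4 - 1 = f4
  generalize hg6 : u * q ^ 2 - 1 = f2
  generalize hg7 : u * q - 1 = f1
  rw [hd4, hd6]
  clear hd4 hd6 e6 e8 h4 h6
  field_simp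
  subst_vars
  ring

theorem kernelValue_one (hq : ∀ n, q ^ (n + 1) - 1 ≠ 0) (k : ℕ) :
    kernelValue q 1 k =
      kernelValue q 0 (k + 1) + (qNum q (k + 1) + recDiag q 0) * kernelValue q 0 k := by
  have h1 : q - 1 ≠ 0 := by simpa using hq 0
  have hn : ∀ n, qNum q (n + 1) ≠ 0 := fun n => div_ne_zero (hq n) h1
  have hf : ∀ n, qFac q n ≠ 0 := fun n => Finset.prod_ne_zero_iff.2 fun i _ => hn i
  set V := (-1) ^ k * q ^ (k + 1) * qFac q (k + 1) ^ 2 / qFac q (k + 4) with hV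
  have e1 : qFac q (k + 4) = qFac q (k + 3) * qNum q (k + 4) := qFac_succ _ _
  have f3 := hf (k + 3)
  have n4 : qNum q (k + 4) ≠ 0 := hn (k + 3)
  have k0 : kernelValue q 0 k = V * qNum q (k + 4) := by
    rw [hV, e1]
    simp only [kernelValue, kernelScale, Finset.prod_range_zero, add_zero, mul_one, one_mul]
    field_simp
  have k1 : kernelValue q 1 k = V * (q * qNum q 2 ^ 2 * qNum q 3 /
      (qNum q 3 * qNum q 4 * (q - 1)) * (q ^ k - 1)) := by
    rw [hV, kernelValue, kernelScale]
    simp only [Finset.prod_range_one, pow_zero, mul_zero, zero_add, show k + 1 + 3 = k + 4 from rfl]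
    ring
  have k2 : kernelValue q 0 (k + 1) = V * -(q * qNum q (k + 2) ^ 2) := by
    rw [hV, kernelValue, kernelScale, qFac_succ q (k + 1)]
    simp only [Finset.prod_range_zero, add_zero, show k + 1 + 3 = k + 4 from rfl]
    ring
  have key := three_term_identity_zero (u := q ^ k) h1 (hq 2) (hq 3) (hq (k + 3)) rfl
    (d1 := q ^ (k + 1) - 1) (d2 := q ^ (k + 2) - 1) (by ring) (by ring) rfl rfl (by ring)
  have hN : ∀ m, (q ^ m - 1) / (q - 1) = qNum q m := fun _ => rfl
  simp only [Nat.reduceAdd, hN] at key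
  have hN1 : qNum q 1 = 1 := by rw [qNum, pow_one, div_self h1]
  rw [k0, k1, k2, recDiag]
  simp only [mul_zero, zero_add, pow_one, hN1]
  linear_combination V * key

/-- This mirrors P_(n+2) = (X + diag) P_(n+1) - off P_n paired with f_k, using X f_k = f_(k+1) +
[k+1] f_k. All four terms share the factor `V`. -/
theorem kernelValue_add_two (hq : ∀ n, q ^ (n + 1) - 1 ≠ 0) (n k : ℕ) :
    kernelValue q (n + 2) k = kernelValue q (n + 1) (k + 1) +
      (qNum q (k + 1) + recDiag q (n + 1)) * kernelValue q (n + 1) k -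
        recOff q n * kernelValue q n k := by
  have h1 : q - 1 ≠ 0 := by simpa using hq 0
  have hn : ∀ n, qNum q (n + 1) ≠ 0 := fun n => div_ne_zero (hq n) h1
  have hf : ∀ n, qFac q n ≠ 0 := fun n => Finset.prod_ne_zero_iff.2 fun i _ => hn i
  set V := kernelScale q n * ((-1) ^ k * q ^ (k + 1) * qFac q (k + 1) ^ 2) *
    (∏ i ∈ Finset.range n, (q ^ k - q ^ i)) / qFac q (k + n + 5) with hV
  set r : ℕ → K := fun n => q * qNum q (n + 2) ^ 2 * qNum q (n + 3) /
    (qNum q (2 * n + 3) * qNum q (2 * n + 4) * (q - 1)) with hr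
  have e2 : qFac q (k + n + 5) = qFac q (k + n + 3) * qNum q (k + n + 4) * qNum q (k + n + 5) := by
    rw [qFac_succ, qFac_succ]
  have e1 : qFac q (k + n + 5) = qFac q (k + n + 4) * qNum q (k + n + 5) := qFac_succ _ _
  have f3 := hf (k + n + 3)
  have f4 := hf (k + n + 4)
  have n4 : qNum q (k + n + 4) ≠ 0 := hn (k + n + 3)
  have n5 : qNum q (k + n + 5) ≠ 0 := hn (k + n + 4)
  have k0 : kernelValue q n k = V * (qNum q (k + n + 5) * qNum q (k + n + 4)) := by
    rw [kernelValue, hV, e2]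
    field_simp
  have k1 : kernelValue q (n + 1) k = V * (r n * (q ^ k - q ^ n) * qNum q (k + n + 5)) := by
    rw [kernelValue, kernelScale_succ, Finset.prod_range_succ, hV, e1, hr,
      show k + (n + 1) + 3 = k + n + 4 by ring]
    simp only
    generalize qNum q (2 * n + 3) * qNum q (2 * n + 4) * (q - 1) = d
    field_simp
  have k2 : kernelValue q (n + 2) k =
      V * (r n * r (n + 1) * ((q ^ k - q ^ n) * (q ^ k - q ^ (n + 1)))) := by
    rw [kernelValue, kernelScale_succ, kernelScale_succ, Finset.prod_range_succ,
      Finset.prod_range_succ, hV, hr, show k + (n + 2) + 3 = k + n + 5 by ring]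
    simp only
    ring
  have k3 : kernelValue q (n + 1) (k + 1) =
      V * (r n * -(q * qNum q (k + 2) ^ 2 * ((q ^ (k + 1) - 1) * q ^ n))) := by
    rw [kernelValue, kernelScale_succ, prod_pow_sub_pow_succ, hV, hr,
      show k + 1 + (n + 1) + 3 = k + n + 5 by ring, qFac_succ q (k + 1)]
    simp only
    ring
  have hN : ∀ m, (q ^ m - 1) / (q - 1) = qNum q m := fun _ => rfl
  have key := three_term_identity (q := q) (u := q ^ k) (s := q ^ n) (w := q - 1)
    (a1 := q ^ (n + 1) - 1) (a2 := q ^ (n + 2) - 1) (a3 := q ^ (n + 3) - 1)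
    (a4 := q ^ (n + 4) - 1) (d3 := q ^ (2 * n + 3) - 1) (d4 := q ^ (2 * n + 4) - 1)
    (d5 := q ^ (2 * n + 5) - 1) (d6 := q ^ (2 * n + 6) - 1) h1 (hq _) (hq _) (hq _) (hq _) rfl
    (by ring) (by ring) (by ring) (by ring) (by ring) (by ring) (by ring) (by ring)
  simp only [← pow_add, ← pow_succ, hN] at key
  rw [k0, k1, k2, k3, recDiag, recOff, hr]
  simp only [show 2 * (n + 1) + 2 = 2 * n + 4 by ring, show 2 * (n + 1) + 3 = 2 * n + 5 by ring,
    show 2 * (n + 1) + 4 = 2 * n + 6 by ring, show n + 1 + 1 = n + 2 by ring,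
    show n + 1 + 2 = n + 3 by ring, show n + 1 + 3 = n + 4 by ring]
  linear_combination V * key

end ThreeTerm

/-! ### Poles at q = 1 -/

-- Compare a/b with the reduced fraction by cross-multiplying and evaluating at x: neither pair of
-- numerator and denominator vanishes simultaneously there.
open Polynomial in
theorem hasPoleAt_iff {f : RatFunc ℚ} {a b : ℚ[X]} {x : ℚ} (hb : b ≠ 0)
    (hf : f = algebraMap ℚ[X] (RatFunc ℚ) a / algebraMap ℚ[X] (RatFunc ℚ) b)
    (h : a.eval x ≠ 0 ∨ b.eval x ≠ 0) : QBernoulli.HasPoleAt f x ↔ b.eval x = 0 := by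
  have hb' : algebraMap ℚ[X] (RatFunc ℚ) b ≠ 0 := RatFunc.algebraMap_ne_zero hb
  have hmul : f.num * b = a * f.denom := by
    apply RatFunc.algebraMap_injective ℚ
    rw [map_mul, map_mul]
    have hd : algebraMap ℚ[X] (RatFunc ℚ) f.denom ≠ 0 :=
      RatFunc.algebraMap_ne_zero f.denom_ne_zero
    exact (div_eq_div_iff hd hb').1 ((RatFunc.num_div_denom f).trans hf)
  have he : f.num.eval x * b.eval x = a.eval x * f.denom.eval x := by
    rw [← eval_mul, hmul, eval_mul]
  obtain ⟨u, v, huv⟩ := RatFunc.isCoprime_num_denom f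
  have hc : u.eval x * f.num.eval x + v.eval x * f.denom.eval x = 1 := by
    rw [← eval_mul, ← eval_mul, ← eval_add, huv, eval_one]
  unfold QBernoulli.HasPoleAt
  constructor
  · intro h0
    rw [h0] at he hc
    rcases mul_eq_zero.1 (he.trans (mul_zero _)) with h1 | h1
    · simp [h1] at hc
    · exact h1
  · intro h0
    rw [h0] at he
    rcases h with h | h
    · exact (mul_eq_zero.1 (he.symm.trans (mul_zero _))).resolve_left h
    · exact absurd h0 h

open Polynomial in
theorem qInt_eq_algebraMap (n : ℕ) :
    QBernoulli.qInt n = algebraMap ℚ[X] (RatFunc ℚ) (∑ i ∈ Finset.range n, X ^ i) := by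
  have h1 : QBernoulli.q - 1 ≠ 0 := by
    simpa using QBernoulli.q_pow_succ_sub_one_ne_zero 0
  rw [QBernoulli.qInt, div_eq_iff h1, ← geom_sum_mul]
  simp [QBernoulli.q]

open Polynomial in
theorem X_pow_choose_add_ne_zero (n : ℕ) :
    (X ^ (n + 2).choose 2 + (-1) ^ (n + 2) : ℚ[X]) ≠ 0 := by
  have hpos : 0 < (n + 2).choose 2 := Nat.choose_pos (by omega)
  have := Polynomial.X_pow_add_C_ne_zero hpos ((-1 : ℚ) ^ (n + 2))
  simpa using this

theorem q_pow_choose_add_ne_zero (n : ℕ) :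
    QBernoulli.q ^ (n + 2).choose 2 + (-1) ^ (n + 2) ≠ 0 := by
  have := RatFunc.algebraMap_ne_zero (X_pow_choose_add_ne_zero n)
  simpa [QBernoulli.q] using this

open Polynomial in
theorem geom_sum_X_ne_zero {n : ℕ} (hn : n ≠ 0) :
    (∑ i ∈ Finset.range n, X ^ i : ℚ[X]) ≠ 0 := by
  intro h
  have := congrArg (eval 1) h
  simp [eval_finsetSum, hn] at this

-- At q = 1, [m] becomes m and T_m becomes 1 + (-1)^m. The two T factors have indices of opposite
-- parity, so exactly one of them vanishes.
open Polynomial in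
theorem odd_coefficient_hasPoleAt_iff {n : ℕ} (hn : 1 ≤ n) :
    QBernoulli.HasPoleAt (QBernoulli.qInt n * QBernoulli.qInt (n + 1) ^ 2 /
      (QBernoulli.qInt (2 * n + 1) * QBernoulli.qInt (2 * n + 2)) *
        ((QBernoulli.q ^ (n + 2).choose 2 + (-1) ^ (n + 2)) /
          (QBernoulli.q ^ (n + 1).choose 2 + (-1) ^ (n + 1)))) 1 ↔ Even n := by
  have hT : (X ^ (n + 1).choose 2 + (-1) ^ (n + 1) : ℚ[X]) ≠ 0 := by
    obtain ⟨n, rfl⟩ := Nat.exists_eq_add_of_le' hn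
    exact X_pow_choose_add_ne_zero n
  have hn0 : n ≠ 0 := by omega
  have c1 : (n : ℚ) + 1 ≠ 0 := by positivity
  have c2 : 2 * (n : ℚ) + 1 ≠ 0 := by positivity
  have c3 : 2 * (n : ℚ) + 2 ≠ 0 := by positivity
  rw [hasPoleAt_iff
    (a := (∑ i ∈ Finset.range n, X ^ i) * (∑ i ∈ Finset.range (n + 1), X ^ i) ^ 2 *
      (X ^ (n + 2).choose 2 + (-1) ^ (n + 2)))
    (b := (∑ i ∈ Finset.range (2 * n + 1), X ^ i) * (∑ i ∈ Finset.range (2 * n + 2), X ^ i) *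
      (X ^ (n + 1).choose 2 + (-1) ^ (n + 1)))]
  · rcases Nat.even_or_odd n with h | h
    · simp [eval_finsetSum, h, pow_succ]
    · simp [eval_finsetSum, c2, c3, h, pow_succ]
  · exact mul_ne_zero (mul_ne_zero (geom_sum_X_ne_zero (by omega)) (geom_sum_X_ne_zero (by omega)))
      hT
  · rw [div_mul_div_comm]
    simp only [qInt_eq_algebraMap, map_mul, map_pow, map_add, map_neg, map_one, QBernoulli.q,
      RatFunc.algebraMap_X]
  · rcases Nat.even_or_odd n with h | h
    · left
      simp [eval_finsetSum, c1, hn0, h, pow_succ]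
    · right
      simp [eval_finsetSum, c2, c3, h, pow_succ]

open Polynomial in
theorem even_coefficient_hasPoleAt_iff {n : ℕ} (hn : 1 ≤ n) :
    QBernoulli.HasPoleAt
      (-(QBernoulli.q ^ (n + 1) * QBernoulli.qInt (n + 1) ^ 2 * QBernoulli.qInt (n + 2)) /
        (QBernoulli.qInt (2 * n + 2) * QBernoulli.qInt (2 * n + 3)) *
          ((QBernoulli.q ^ (n + 1).choose 2 + (-1) ^ (n + 1)) /
            (QBernoulli.q ^ (n + 2).choose 2 + (-1) ^ (n + 2)))) 1 ↔ Odd n := by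
  have hT := X_pow_choose_add_ne_zero n
  have hn0 : n ≠ 0 := by omega
  have c1 : (n : ℚ) + 1 ≠ 0 := by positivity
  have c2 : (n : ℚ) + 2 ≠ 0 := by positivity
  have c3 : 2 * (n : ℚ) + 2 ≠ 0 := by positivity
  have c4 : 2 * (n : ℚ) + 3 ≠ 0 := by positivity
  rw [hasPoleAt_iff
    (a := -(X ^ (n + 1) * (∑ i ∈ Finset.range (n + 1), X ^ i) ^ 2 *
      (∑ i ∈ Finset.range (n + 2), X ^ i)) * (X ^ (n + 1).choose 2 + (-1) ^ (n + 1)))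
    (b := (∑ i ∈ Finset.range (2 * n + 2), X ^ i) * (∑ i ∈ Finset.range (2 * n + 3), X ^ i) *
      (X ^ (n + 2).choose 2 + (-1) ^ (n + 2)))]
  · rcases Nat.even_or_odd n with h | h
    · simp [eval_finsetSum, c3, c4, h, pow_succ]
    · simp [eval_finsetSum, h, pow_succ]
  · exact mul_ne_zero (mul_ne_zero (geom_sum_X_ne_zero (by omega)) (geom_sum_X_ne_zero (by omega)))
      hT
  · rw [div_mul_div_comm]
    simp only [qInt_eq_algebraMap, map_mul, map_pow, map_add, map_neg, map_one, QBernoulli.q,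
      RatFunc.algebraMap_X]
  · rcases Nat.even_or_odd n with h | h
    · right
      simp [eval_finsetSum, c3, c4, h, pow_succ]
    · left
      simp [eval_finsetSum, c1, c2, h, pow_succ]

/-! ### Failure for the classical Bernoulli numbers -/

theorem not_isSFraction_classicalBhat2 (c : ℕ → ℚ) :
    ¬ QBernoulli.IsSFraction QBernoulli.classicalBhat2 c := by
  intro h
  have h3 : bernoulli 3 = 0 := bernoulli_eq_zero_of_odd (by decide) (by norm_num)
  have h4 : bernoulli 4 ≠ 0 := by
    rw [bernoulli_eq_bernoulli'_of_ne_one (by norm_num), bernoulli'_four]; norm_num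
  have hconst : ∀ (m : ℕ) (d : ℕ → ℚ),
      PowerSeries.constantCoeff (QBernoulli.sConvergent m d) = 1 := by
    intro m d
    cases m <;> simp [QBernoulli.sConvergent]
  have hc : c 1 = 0 := by
    obtain ⟨m, hm, hm'⟩ := ((h 1).and (Filter.eventually_ge_atTop 1)).exists
    obtain ⟨m, rfl⟩ := Nat.exists_eq_add_of_le' hm'
    rw [QBernoulli.sConvergent] at hm
    set S := QBernoulli.sConvergent m fun k => c (k + 1) with hS
    set U := 1 + PowerSeries.C (c 1) * PowerSeries.X * S with hU
    have hU0 : PowerSeries.constantCoeff U = 1 := by simp [hU]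
    have hinv : U * U⁻¹ = 1 := PowerSeries.mul_inv_cancel U (by simp [hU0])
    have h1 := congrArg (PowerSeries.coeff 1) hinv
    have hU1 : PowerSeries.coeff 1 U = c 1 := by
      rw [hU, mul_assoc, map_add, PowerSeries.coeff_C_mul, PowerSeries.coeff_succ_X_mul,
        PowerSeries.coeff_zero_eq_constantCoeff_apply, hconst]
      simp [PowerSeries.coeff_one]
    rw [PowerSeries.coeff_mul, Finset.Nat.antidiagonal_succ] at h1
    simp [PowerSeries.coeff_one, hU0, hU1, hm, QBernoulli.classicalBhat2, h3] at h1
    exact h1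
  obtain ⟨m, hm, hm'⟩ := ((h 2).and (Filter.eventually_ge_atTop 1)).exists
  obtain ⟨m, rfl⟩ := Nat.exists_eq_add_of_le' hm'
  rw [QBernoulli.sConvergent, hc] at hm
  have h1 : (1 : PowerSeries ℚ)⁻¹ = 1 := by
    simp
  simp [h1, PowerSeries.coeff_one, QBernoulli.classicalBhat2, h4] at hm

/-! ### The continued fraction of the shifted q-Bernoulli series -/

section CarlitzContinuedFraction

open Polynomial

/-- The pair `(P_n, B_n)` of polynomials generated by the coefficients `c` of a continued
fraction. -/
noncomputable def convergentPolys {K : Type*} [Field K] (c : ℕ → K) : ℕ → K[X] × K[X]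
  | 0 => (1, 1)
  | n + 1 =>
    (X * (convergentPolys c n).2 + C (c (2 * n + 1)) * (convergentPolys c n).1,
      X * (convergentPolys c n).2 + C (c (2 * n + 1)) * (convergentPolys c n).1 +
        C (c (2 * n + 2)) * (convergentPolys c n).2)

theorem map_convergentPolys_eq_zero {K : Type*} [Field K] {q : K} (hq : ∀ n, q ^ (n + 1) - 1 ≠ 0)
    (M : K[X] →ₗ[K] K) (hM : ∀ k, M (qFalling q 1 k) = kernelValue q 0 k) (c : ℕ → K)
    (hc1 : c 1 = recDiag q 0) (hdiag : ∀ n, c (2 * n + 2) + c (2 * n + 3) = recDiag q (n + 1))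
    (hoff : ∀ n, c (2 * n + 1) * c (2 * n + 2) = recOff q n) (n : ℕ) :
    M (convergentPolys c (n + 1)).1 = 0 := by
  have h1 : (convergentPolys c 1).1 = X + C (c 1) := by simp [convergentPolys]
  have h2 : ∀ n, (convergentPolys c (n + 2)).1 = (X + C (recDiag q (n + 1))) *
      (convergentPolys c (n + 1)).1 - C (recOff q n) * (convergentPolys c n).1 := by
    intro n
    rw [← hdiag, ← hoff]
    simp only [convergentPolys, show 2 * (n + 1) + 1 = 2 * n + 3 by ring, C_add, C_mul]
    ring
  -- Two consecutive n are carried along because the recurrence has order two.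
  have key : ∀ n, (∀ k, M (qFalling q 1 k * (convergentPolys c n).1) = kernelValue q n k) ∧
      ∀ k, M (qFalling q 1 k * (convergentPolys c (n + 1)).1) = kernelValue q (n + 1) k := by
    intro n
    induction n with
    | zero =>
      refine ⟨fun k => by simpa [convergentPolys] using hM k, fun k => ?_⟩
      rw [h1, mul_add, mul_comm, X_mul_qFalling, mul_comm _ (C (c 1)), map_add, map_add, map_C_mul,
        map_C_mul, hM, hM, kernelValue_one hq, hc1]
      ring
    | succ n ih =>
      refine ⟨ih.2, fun k => ?_⟩
      rw [h2, show qFalling q 1 k * ((X + C (recDiag q (n + 1))) * (convergentPolys c (n + 1)).1 -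
        C (recOff q n) * (convergentPolys c n).1) =
        (X * qFalling q 1 k) * (convergentPolys c (n + 1)).1 +
        C (recDiag q (n + 1)) * (qFalling q 1 k * (convergentPolys c (n + 1)).1) -
        C (recOff q n) * (qFalling q 1 k * (convergentPolys c n).1) by ring, X_mul_qFalling,
        add_mul, mul_assoc, map_sub, map_add, map_add, map_C_mul, map_C_mul, map_C_mul, ih.1, ih.2,
        ih.2, kernelValue_add_two hq]
      ring
  -- At k = 0 the factor i = 0 of the product is q^0 - q^0.
  have h := (key n).2 0
  rw [kernelValue, Finset.prod_eq_zero (i := 0) (by simp) (by simp)] at h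
  simpa [qFalling] using h

/-- The coefficients of the continued fraction. -/
noncomputable def carlitzCoeff (k : ℕ) : RatFunc ℚ :=
  if Even k then
    -(QBernoulli.q ^ (k / 2 + 1) * QBernoulli.qInt (k / 2 + 1) ^ 2 * QBernoulli.qInt (k / 2 + 2)) /
        (QBernoulli.qInt (k + 2) * QBernoulli.qInt (k + 3)) *
      ((QBernoulli.q ^ (k / 2 + 1).choose 2 + (-1) ^ (k / 2 + 1)) /
        (QBernoulli.q ^ (k / 2 + 2).choose 2 + (-1) ^ (k / 2 + 2)))
  else
    QBernoulli.qInt (k / 2 + 1) * QBernoulli.qInt (k / 2 + 2) ^ 2 /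
        (QBernoulli.qInt (k + 2) * QBernoulli.qInt (k + 3)) *
      ((QBernoulli.q ^ (k / 2 + 3).choose 2 + (-1) ^ (k / 2 + 3)) /
        (QBernoulli.q ^ (k / 2 + 2).choose 2 + (-1) ^ (k / 2 + 2)))

theorem carlitzCoeff_even (n : ℕ) : carlitzCoeff (2 * n) =
    -(QBernoulli.q ^ (n + 1) * QBernoulli.qInt (n + 1) ^ 2 * QBernoulli.qInt (n + 2)) /
        (QBernoulli.qInt (2 * n + 2) * QBernoulli.qInt (2 * n + 3)) *
      ((QBernoulli.q ^ (n + 1).choose 2 + (-1) ^ (n + 1)) /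
        (QBernoulli.q ^ (n + 2).choose 2 + (-1) ^ (n + 2))) := by
  rw [carlitzCoeff, if_pos (even_two_mul n), show 2 * n / 2 = n by omega]

theorem carlitzCoeff_odd (n : ℕ) : carlitzCoeff (2 * n + 1) =
    QBernoulli.qInt (n + 1) * QBernoulli.qInt (n + 2) ^ 2 /
        (QBernoulli.qInt (2 * n + 3) * QBernoulli.qInt (2 * n + 4)) *
      ((QBernoulli.q ^ (n + 3).choose 2 + (-1) ^ (n + 3)) /
        (QBernoulli.q ^ (n + 2).choose 2 + (-1) ^ (n + 2))) := by
  rw [carlitzCoeff, if_neg (by simp), show (2 * n + 1) / 2 = n by omega]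

theorem qInt_eq_qNum (n : ℕ) : QBernoulli.qInt n = qNum QBernoulli.q n := rfl

theorem choose_two_succ (n : ℕ) : (n + 1).choose 2 = n.choose 2 + n := by
  rw [Nat.choose_succ_succ' n 1, Nat.choose_one_right, add_comm]

theorem carlitzCoeff_one : carlitzCoeff 1 = recDiag QBernoulli.q 0 := by
  have h1 := QBernoulli.q_pow_succ_sub_one_ne_zero 0
  have h2 := QBernoulli.q_pow_succ_sub_one_ne_zero 1
  have h3 := QBernoulli.q_pow_succ_sub_one_ne_zero 2
  have h4 := QBernoulli.q_pow_succ_sub_one_ne_zero 3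
  have ht := q_pow_choose_add_ne_zero 0
  rw [show (1 : ℕ) = 2 * 0 + 1 from rfl, carlitzCoeff_odd, recDiag]
  simp only [qInt_eq_qNum, qNum]
  generalize QBernoulli.q = q at *
  simp [Nat.choose] at *
  have h4' : q ^ 4 - 1 = (q ^ 2 - 1) * (q ^ 2 + 1) := by ring
  obtain ⟨-, h6⟩ := mul_ne_zero_iff.1 (h4' ▸ h4)
  rw [h4']
  field_simp
  ring

theorem carlitzCoeff_mul (n : ℕ) :
    carlitzCoeff (2 * n + 1) * carlitzCoeff (2 * n + 2) = recOff QBernoulli.q n := by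
  have ht := q_pow_choose_add_ne_zero n
  have ht' := q_pow_choose_add_ne_zero (n + 1)
  rw [show 2 * n + 2 = 2 * (n + 1) by ring, carlitzCoeff_odd, carlitzCoeff_even, recOff]
  simp only [qInt_eq_qNum, show 2 * (n + 1) + 2 = 2 * n + 4 by ring,
    show 2 * (n + 1) + 3 = 2 * n + 5 by ring, show n + 1 + 1 = n + 2 by ring,
    show n + 1 + 2 = n + 3 by ring] at ht' ⊢
  have key : ∀ a b c d f g : RatFunc ℚ, f ≠ 0 → g ≠ 0 →
      a / b * (f / g) * (c / d * (g / f)) = a * c / (b * d) := by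
    intro a b c d f g hf hg
    rw [mul_mul_mul_comm, div_mul_div_comm, div_mul_div_cancel₀ hg, div_self hf, mul_one]
  rw [key _ _ _ _ _ _ ht' ht]
  congr 1 <;> ring

/-- Let A and B be the two terms on the right. After multiplying by T the sign e cancels, leaving A
(1 + s q^2) = B s q^2 (1 + s q^3), which follows from d4 = a2 (1 + s q^2) and d6 = a3 (1 + s q^3).
-/
theorem coefficient_add_identity {K : Type*} [Field K] {q w s t e a2 a3 d4 d5 d6 T : K}
    (hw : w ≠ 0) (h4 : d4 ≠ 0) (h5 : d5 ≠ 0) (h6 : d6 ≠ 0) (hT : T ≠ 0)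
    (ew : w = q - 1) (e2 : a2 = s * q ^ 2 - 1) (e3 : a3 = s * q ^ 3 - 1)
    (e4 : d4 = s ^ 2 * q ^ 4 - 1) (e6 : d6 = s ^ 2 * q ^ 6 - 1) (eT : T = t * s * q ^ 2 - e) :
    -(s * q ^ 2 * (a2 / w) ^ 2 * (a3 / w)) / (d4 / w * (d5 / w)) * ((t + e) / T) +
      a2 / w * (a3 / w) ^ 2 / (d5 / w * (d6 / w)) * ((t * s ^ 2 * q ^ 5 + e) / T) =
    s * q ^ 2 * (a2 / w) ^ 2 * (a3 / w) / (d4 / w * (d5 / w)) -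
      a2 / w * (a3 / w) ^ 2 / (d5 / w * (d6 / w)) := by
  have hd4 : d4 = a2 * (s * q ^ 2 + 1) := by subst_vars; ring
  have hd6 : d6 = a3 * (s * q ^ 3 + 1) := by subst_vars; ring
  obtain ⟨ha2, hb2⟩ := mul_ne_zero_iff.1 (hd4 ▸ h4)
  obtain ⟨ha3, hb3⟩ := mul_ne_zero_iff.1 (hd6 ▸ h6)
  generalize hg2 : s * q ^ 2 + 1 = b2 at hd4 hb2
  generalize hg3 : s * q ^ 3 + 1 = b3 at hd6 hb3
  rw [hd4, hd6]
  clear hd4 hd6 e4 e6 h4 h6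
  field_simp
  subst_vars
  ring

theorem carlitzCoeff_add (n : ℕ) :
    carlitzCoeff (2 * n + 2) + carlitzCoeff (2 * n + 3) = recDiag QBernoulli.q (n + 1) := by
  have ht := q_pow_choose_add_ne_zero (n + 1)
  have hq := QBernoulli.q_pow_succ_sub_one_ne_zero
  rw [show 2 * n + 2 = 2 * (n + 1) by ring, show 2 * n + 3 = 2 * (n + 1) + 1 by ring,
    carlitzCoeff_odd, carlitzCoeff_even, recDiag]
  have h := coefficient_add_identity (q := QBernoulli.q) (s := QBernoulli.q ^ n)
    (t := QBernoulli.q ^ (n + 2).choose 2) (e := (-1) ^ (n + 2))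
    (a2 := QBernoulli.q ^ (n + 2) - 1) (a3 := QBernoulli.q ^ (n + 3) - 1)
    (d4 := QBernoulli.q ^ (2 * n + 4) - 1) (d5 := QBernoulli.q ^ (2 * n + 5) - 1)
    (d6 := QBernoulli.q ^ (2 * n + 6) - 1)
    (T := QBernoulli.q ^ (n + 1 + 2).choose 2 + (-1) ^ (n + 1 + 2)) (w := QBernoulli.q - 1)
    (by simpa using hq 0) (hq _) (hq _) (hq _) ht rfl (by ring) (by ring) (by ring) (by ring)
    (by rw [choose_two_succ (n + 2)]; ring)
  have h3 : QBernoulli.q ^ (n + 1 + 3).choose 2 + (-1) ^ (n + 1 + 3) =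
      QBernoulli.q ^ (n + 2).choose 2 * (QBernoulli.q ^ n) ^ 2 * QBernoulli.q ^ 5 +
        (-1) ^ (n + 2) := by
    rw [choose_two_succ (n + 3), choose_two_succ (n + 2)]
    ring
  rw [h3]
  have hN : ∀ m, (QBernoulli.q ^ m - 1) / (QBernoulli.q - 1) = qNum QBernoulli.q m := fun _ => rfl
  simp only [hN, ← pow_add] at h
  exact h

theorem isSFraction_Bhat2 : QBernoulli.IsSFraction QBernoulli.Bhat2 carlitzCoeff := by
  have hq := QBernoulli.q_pow_succ_sub_one_ne_zero
  have h1 : QBernoulli.q - 1 ≠ 0 := by simpa using hq 0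
  set M := shiftTwo (umbral QBernoulli.beta) with hMdef
  have hM : ∀ k, M (qFalling QBernoulli.q 1 k) = kernelValue QBernoulli.q 0 k := by
    intro k
    rw [hMdef, shiftTwo_umbral_qFalling hq QBernoulli.carlitz_relation (by simp [QBernoulli.carlitzRhs])
      (by simp [QBernoulli.carlitzRhs]) (by simp [QBernoulli.carlitzRhs])]
    simp [kernelValue, kernelScale]
  have hMX : ∀ n, M (X ^ n) = QBernoulli.beta (n + 2) := by
    intro n
    rw [hMdef, shiftTwo_apply, ← pow_add, umbral_X_pow, add_comm]
  -- M(1) = β_2 is the closed form at n = k = 0, a quotient of nonzero factors; dividing M by it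
  -- normalises the functional.
  have hβ : QBernoulli.beta 2 ≠ 0 := by
    have h := hM 0
    have hn : ∀ n, qNum QBernoulli.q (n + 1) ≠ 0 := fun n => div_ne_zero (hq n) h1
    have hf : ∀ n, qFac QBernoulli.q n ≠ 0 := fun n => Finset.prod_ne_zero_iff.2 fun i _ => hn i
    have h2 : qFalling QBernoulli.q 1 0 = X ^ 0 := by simp [qFalling]
    rw [h2, hMX] at h
    rw [h]
    have hq0 : QBernoulli.q ≠ 0 := RatFunc.X_ne_zero
    simp [kernelValue, kernelScale, hf, hq0]
  have hF : QBernoulli.Bhat2 =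
      PowerSeries.mk fun n => ((QBernoulli.beta 2)⁻¹ • M) (X ^ n) := by
    ext n
    rw [QBernoulli.Bhat2, PowerSeries.coeff_mk, PowerSeries.coeff_mk, LinearMap.smul_apply, hMX,
      smul_eq_mul, div_eq_inv_mul]
  rw [hF]
  refine isSFraction_of_functional _ _ (fun n => (convergentPolys carlitzCoeff n).1)
    (fun n => (convergentPolys carlitzCoeff n).2) rfl rfl (fun n => rfl) (fun n => rfl) ?_ ?_
  · have := hMX 0
    rw [pow_zero] at this
    rw [LinearMap.smul_apply, this, smul_eq_mul, inv_mul_cancel₀ hβ]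
  · intro n
    rw [LinearMap.smul_apply, map_convergentPolys_eq_zero hq M hM _ carlitzCoeff_one
      carlitzCoeff_add carlitzCoeff_mul, smul_zero]

end CarlitzContinuedFraction

theorem mainTheorem8 :
    (∃ c : ℕ → RatFunc ℚ,
      (∀ n : ℕ, 1 ≤ n →
        c (2 * n - 1) =
          QBernoulli.qInt n * QBernoulli.qInt (n + 1) ^ 2 /
              (QBernoulli.qInt (2 * n + 1) * QBernoulli.qInt (2 * n + 2)) *
            ((QBernoulli.q ^ (n + 2).choose 2 + (-1) ^ (n + 2)) /
              (QBernoulli.q ^ (n + 1).choose 2 + (-1) ^ (n + 1)))) ∧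
      (∀ n : ℕ, 1 ≤ n →
        c (2 * n) =
          -(QBernoulli.q ^ (n + 1) * QBernoulli.qInt (n + 1) ^ 2 * QBernoulli.qInt (n + 2)) /
              (QBernoulli.qInt (2 * n + 2) * QBernoulli.qInt (2 * n + 3)) *
            ((QBernoulli.q ^ (n + 1).choose 2 + (-1) ^ (n + 1)) /
              (QBernoulli.q ^ (n + 2).choose 2 + (-1) ^ (n + 2)))) ∧
      QBernoulli.IsSFraction QBernoulli.Bhat2 c ∧
      (∀ n : ℕ, 1 ≤ n →
        (QBernoulli.HasPoleAt (c (2 * n - 1)) 1 ↔ Even n) ∧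
        (QBernoulli.HasPoleAt (c (2 * n)) 1 ↔ Odd n))) ∧
    ¬ ∃ c : ℕ → ℚ, QBernoulli.IsSFraction QBernoulli.classicalBhat2 c := by
  have hodd : ∀ n : ℕ, 1 ≤ n → carlitzCoeff (2 * n - 1) =
      QBernoulli.qInt n * QBernoulli.qInt (n + 1) ^ 2 /
          (QBernoulli.qInt (2 * n + 1) * QBernoulli.qInt (2 * n + 2)) *
        ((QBernoulli.q ^ (n + 2).choose 2 + (-1) ^ (n + 2)) /
          (QBernoulli.q ^ (n + 1).choose 2 + (-1) ^ (n + 1))) := by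
    intro n hn
    obtain ⟨n, rfl⟩ := Nat.exists_eq_add_of_le' hn
    -- After replacing n by n+1, the index 2(n+1) - 1 and the q-integer indices agree with those of
    -- the lemma by computation.
    exact carlitzCoeff_odd n
  refine ⟨⟨carlitzCoeff, hodd, fun n _ => carlitzCoeff_even n, isSFraction_Bhat2, fun n hn => ?_⟩,
    fun ⟨c, hc⟩ => not_isSFraction_classicalBhat2 c hc⟩
  rw [hodd n hn, carlitzCoeff_even]
  exact ⟨odd_coefficient_hasPoleAt_iff hn, even_coefficient_hasPoleAt_iff hn⟩
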